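/- **Setting.** A network has nodes $\mathcal K=\{1,\dots,K\}$; node $k$ observes an $M_k$-channel signal $\mathbf y_k$, $\mathbf y=[\mathbf y_1^T,\dots,\mathbf y_K^T]^T$, $M=\sum_k M_k$, and $X=[X_1^T,\dots,X_K^T]^T\in\mathbb R^{M\times Q}$ with blocks $X_k\in\mathbb R^{M_k\times Q}$. Consider the problem $$\min_{X\in\mathbb R^{M\times Q}} L(X)=f(X)+g(X)\quad\text{s.t. } X\in\mathcal X,\qquad f(X)=\varphi(X^T\mathbf y,X^TB),\quad g(X)=\gamma(X^TA),$$ $$\mathcal X=\{X:\ \forall k,\ \eta_j(X_k^T\mathbf y_k,X_k^TD_{j,k})\le 0\ (j\in\mathcal J_I^k),\ \ \eta_j(X_k^T\mathbf y_k,X_k^TD_{j,k})=0\ (j\in\mathcal J_E^k)\},$$ where $B$, $D_{j,k}$ and the block diagonal matrix $A=\mathrm{blkdiag}(A_1,\dots,A_K)$ are deterministic, $\varphi$ and the $\eta_j$ are real-valued and smooth in the sense that $f$ and the maps $X_k\mapsto\eta_j(X_k^T\mathbf y_k,X_k^TD_{j,k})$ are continuously differentiable, and $\gamma$ is real-valued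 and separable over the nodes: there are functions $\gamma_k$ with $\gamma(X^TA)=\sum_k\gamma_k(X_k^TA_k)$ for all $X$. For a node $q$ let $C_q(X)$ be the matrix with $C_q(X)^T\mathbf y=[\mathbf y_q^T,(X_1^T\mathbf y_1)^T,\dots,(X_{q-1}^T\mathbf y_{q-1})^T,(X_{q+1}^T\mathbf y_{q+1})^T,\dots,(X_K^T\mathbf y_K)^T]^T$, i.e. $C_q(X)V$ has $q$-th block $V_q$ and $k$-th block $X_kV_k$ for $k\ne q$. Let $\mathcal S_q(X)$ be the set of $U\in\mathbb R^{M\times Q}$ whose columns lie in the range of $C_q(X)$, and let $F_q(X)=\operatorname{argmin}\{L(U): U\in\mathcal X\cap\mathcal S_q(X)\}$. The algorithm is $X^{i+1}\in F_{q^i}(X^i)$, and its fixed points are the $X$ with $X\in F_k(X)$ for all $k\in\mathcal K$. With respect to the Frobenius inner product, $\nabla f$ denotes the gradient, $\partial g$ the convex subdifferential and $N_{\mathcal X}(X)$ the (limiting, Rockafellar–Wets) normal cone to $\mathcal X$ at $X$. **Proposition 3 (Optimality in fully-connected networks).** Assume that $L$ is continuous on $\mathcal X$ with compact sublevel sets $\{X\in\mathcal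 X: L(X)\le c\}$, $c\in\mathbb R$, and that $\gamma$ is closed, convex and proper. Let $X^\circ$ be a fixed point of the algorithm such that for every $k\in\mathcal K$ $$\forall\, U\in N_{\mathcal X}(X^\circ):\quad C_k(X^\circ)^TU=0\ \Rightarrow\ U=0.$$ Then $X^\circ$ is a stationary point of the global problem: $$0\in\nabla f(X^\circ)+\partial g(X^\circ)+N_{\mathcal X}(X^\circ).$$ -/

import Mathlib

open Filter Topology
open scoped Matrix Pointwise RealInnerProductSpace Matrix.Norms.Frobenius

/-! ### The Frobenius inner product on real matrices -/

section Frobenius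

variable {m n : Type*} [Fintype m] [Fintype n]

/-- The Frobenius inner product `⟪X, Y⟫ = tr (Xᵀ Y)`, which induces the Frobenius norm. -/
noncomputable instance frobeniusInnerProductSpace : InnerProductSpace ℝ (Matrix m n ℝ) where
  inner X Y := (Xᵀ * Y).trace
  norm_sq_eq_re_inner X := by
    have h : (0 : ℝ) ≤ ∑ i, ∑ j, X i j ^ 2 := by positivity
    rw [Matrix.frobenius_norm_def, ← Real.sqrt_eq_rpow]
    simp only [Real.rpow_two, Real.norm_eq_abs, sq_abs]
    rw [Real.sq_sqrt h, Finset.sum_comm]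
    simp [Matrix.trace, Matrix.mul_apply, pow_two]
  conj_inner_symm X Y := by
    change (Yᵀ * X).trace = (Xᵀ * Y).trace
    rw [← Matrix.trace_transpose, Matrix.transpose_mul, Matrix.transpose_transpose]
  add_left X Y Z := by
    change ((X + Y)ᵀ * Z).trace = (Xᵀ * Z).trace + (Yᵀ * Z).trace
    rw [Matrix.transpose_add, Matrix.add_mul, Matrix.trace_add]
  smul_left X Y r := by
    change ((r • X)ᵀ * Y).trace = r * (Xᵀ * Y).trace
    rw [Matrix.transpose_smul, Matrix.smul_mul, Matrix.trace_smul, smul_eq_mul]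

end Frobenius

/-! ### Normal cones, subdifferentials, stationary points -/

section Variational

variable {E : Type*} [NormedAddCommGroup E] [InnerProductSpace ℝ E]

/-- The regular (Fréchet) normals to `C` at `x ∈ C`: the vectors `v` such that
`⟪v, x' - x⟫ ≤ o(‖x' - x‖)` for `x' ∈ C`, `x' → x`. -/
def regularNormalCone (C : Set E) (x : E) : Set E :=
  {v | x ∈ C ∧ ∀ ε > 0, ∃ δ > 0, ∀ x' ∈ C, ‖x' - x‖ < δ → ⟪v, x' - x⟫ ≤ ε * ‖x' - x‖}

/-- The normal cone of variational analysis (Rockafellar--Wets): the limits of regular normals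
at points of `C` that converge to `x ∈ C`. -/
def normalCone (C : Set E) (x : E) : Set E :=
  {v | x ∈ C ∧ ∃ (xs vs : ℕ → E), Tendsto xs atTop (𝓝 x) ∧ Tendsto vs atTop (𝓝 v) ∧
    ∀ n, vs n ∈ regularNormalCone C (xs n)}

/-- The subdifferential of a convex function `g` at `x`: the slopes of the affine minorants of `g`
that are exact at `x`. -/
def subdifferential (g : E → ℝ) (x : E) : Set E :=
  {v | ∀ u, g x + ⟪v, u - x⟫ ≤ g u}

/-- `x` is a stationary point of "minimize `f + g` over `C`" (`f` smooth, `g` convex):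
`0 ∈ ∇f(x) + ∂g(x) + N_C(x)`, with Minkowski sums. -/
def IsStationaryPoint [CompleteSpace E] (f g : E → ℝ) (C : Set E) (x : E) : Prop :=
  (0 : E) ∈ ({gradient f x} : Set E) + subdifferential g x + normalCone C x

end Variational

/-! ### The spatial filtering problem -/

universe u v

/-- The data of a distributed spatial filtering problem with `K` nodes and `Q` output channels.
`H` is the real vector space of scalar signals (for instance a Hilbert space of random variables,
a space of stochastic processes, or `ℝᴺ` for blocks of `N` samples); the functions `φ` and `η` of
signals may contain arbitrary statistics (expectations, covariances, ...) of their arguments. -/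
structure FilterProblem (K Q : ℕ) (H : Type u) [AddCommGroup H] [Module ℝ H] where
  /-- node `k` has `M k` channels -/
  M : Fin K → ℕ
  /-- the network-wide signal; its channels are indexed by pairs (node, channel of that node) -/
  y : (k : Fin K) × Fin (M k) → H
  /-- numbers of columns of the diagonal blocks of `A` -/
  a : Fin K → ℕ
  /-- the diagonal blocks of the block diagonal matrix `A` -/
  Ablk : ∀ k, Matrix (Fin (M k)) (Fin (a k)) ℝ
  /-- number of columns of `B` -/
  b : ℕ
  B : Matrix ((k : Fin K) × Fin (M k)) (Fin b) ℝ
  /-- the smooth part of the objective -/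
  φ : (Fin Q → H) → Matrix (Fin Q) (Fin b) ℝ → ℝ
  /-- the possibly non-smooth regularizer -/
  γ : Matrix (Fin Q) ((k : Fin K) × Fin (a k)) ℝ → ℝ
  /-- labels of the constraints of node `k` -/
  J : Fin K → Type v
  /-- labels of the inequality constraints -/
  JI : ∀ k, Set (J k)
  /-- labels of the equality constraints -/
  JE : ∀ k, Set (J k)
  /-- number of columns of `D k j` -/
  d : ∀ k, J k → ℕ
  D : ∀ k (j : J k), Matrix (Fin (M k)) (Fin (d k j)) ℝ
  /-- the constraint functions -/
  η : ∀ k (j : J k), (Fin Q → H) → Matrix (Fin Q) (Fin (d k j)) ℝ → ℝ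

/-- The output `Xᵀ y` of the filter `X` applied to a signal `y` with channels `ι`. -/
def filterOutput {ι : Type*} [Fintype ι] {Q : ℕ} {H : Type*} [AddCommGroup H] [Module ℝ H]
    (X : Matrix ι (Fin Q) ℝ) (y : ι → H) : Fin Q → H :=
  fun s => ∑ i, X i s • y i

namespace FilterProblem

variable {K Q : ℕ} {H : Type u} [AddCommGroup H] [Module ℝ H] (P : FilterProblem.{u, v} K Q H)

/-- The network-wide channels (rows of the filter). -/
abbrev Channel : Type := (k : Fin K) × Fin (P.M k)

/-- The space `ℝ^{M × Q}` of filters, with `M = ∑ k, M k`. -/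
abbrev Filt : Type := Matrix P.Channel (Fin Q) ℝ

/-- The block `X_k` of a filter `X`. -/
def blk (X : P.Filt) (k : Fin K) : Matrix (Fin (P.M k)) (Fin Q) ℝ :=
  Matrix.of fun i s => X ⟨k, i⟩ s

/-- The block diagonal matrix `A`. -/
def A : Matrix P.Channel ((k : Fin K) × Fin (P.a k)) ℝ :=
  Matrix.blockDiagonal' P.Ablk

/-- The signal `y_k` of node `k`. -/
def nodeSignal (k : Fin K) : Fin (P.M k) → H := fun i => P.y ⟨k, i⟩

/-- `f(X) = φ(Xᵀ y, Xᵀ B)`. -/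
def f (X : P.Filt) : ℝ := P.φ (filterOutput X P.y) (Xᵀ * P.B)

/-- `g(X) = γ(Xᵀ A)`. -/
def g (X : P.Filt) : ℝ := P.γ (Xᵀ * P.A)

/-- The objective `L = f + g`. -/
def L (X : P.Filt) : ℝ := P.f X + P.g X

/-- The `j`-th constraint function of node `k`: `X_k ↦ η_j(X_kᵀ y_k, X_kᵀ D_{j,k})`. -/
def constraint (k : Fin K) (j : P.J k) (Xk : Matrix (Fin (P.M k)) (Fin Q) ℝ) : ℝ :=
  P.η k j (filterOutput Xk (P.nodeSignal k)) (Xkᵀ * P.D k j)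

/-- The set `𝒳` of feasible filters. -/
def feasible : Set P.Filt :=
  {X | ∀ k, (∀ j ∈ P.JI k, P.constraint k j (P.blk X k) ≤ 0) ∧
    ∀ j ∈ P.JE k, P.constraint k j (P.blk X k) = 0}

/-- What is required of every problem: the objective `f` and the constraint functions are smooth,
as functions of the filter coefficients, and the regularizer is separable over the nodes. -/
structure IsAdmissible : Prop where
  smooth_objective : ContDiff ℝ 1 P.f
  smooth_constraints : ∀ k, ∀ j ∈ P.JI k ∪ P.JE k, ContDiff ℝ 1 (P.constraint k j)
  separable : ∃ γblk : ∀ k, Matrix (Fin Q) (Fin (P.a k)) ℝ → ℝ,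
    ∀ X : P.Filt, P.γ (Xᵀ * P.A) = ∑ k, γblk k ((P.blk X k)ᵀ * P.Ablk k)

/-- `L` is continuous on the feasible set and has compact sublevel sets there, and the
(real-valued, hence proper) regularizer `γ` is closed and convex. -/
structure ContinuityCompactnessCCP : Prop where
  continuousOn : ContinuousOn P.L P.feasible
  compact_sublevel : ∀ c : ℝ, IsCompact {X | X ∈ P.feasible ∧ P.L X ≤ c}
  convex : ConvexOn ℝ Set.univ P.γ
  closed : LowerSemicontinuous P.γ

/-! ### The algorithm in fully-connected networks -/

/-- The rows of the local variable at updating node `q`: first the `M q` channels of `q` itself,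
then `Q` compressed channels for each other node. -/
abbrev LocalChannel (q : Fin K) : Type := Fin (P.M q) ⊕ ({k : Fin K // k ≠ q} × Fin Q)

/-- The matrix `C_q(X)`, which compresses the network-wide data to the data available at the
updating node `q`: `C_q(X)ᵀ y` consists of `y_q` and of the `X_kᵀ y_k`, `k ≠ q`. -/
def C (q : Fin K) (X : P.Filt) : Matrix P.Channel (P.LocalChannel q) ℝ :=
  Matrix.of fun r c =>
    match c with
    | Sum.inl i => if r = ⟨q, i⟩ then 1 else 0
    | Sum.inr (k, s) => if r.1 = k.1 then X r s else 0

/-- `𝒮_q(X)`: the filters whose columns lie in the range of `C_q(X)`. -/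
def S (q : Fin K) (X : P.Filt) : Set P.Filt :=
  {U | ∃ V : Matrix (P.LocalChannel q) (Fin Q) ℝ, U = P.C q X * V}

/-- `F_q(X) = argmin {L(U) | U ∈ 𝒳 ∩ 𝒮_q(X)}`: the possible next iterates after `X` when `q` is
the updating node. -/
def F (q : Fin K) (X : P.Filt) : Set P.Filt :=
  {U | U ∈ P.feasible ∩ P.S q X ∧ ∀ V ∈ P.feasible ∩ P.S q X, P.L U ≤ P.L V}

/-- `X` is a fixed point of the algorithm: `X ∈ F_k(X)` for every node `k`. -/
def IsFixedPoint (X : P.Filt) : Prop := ∀ k, X ∈ P.F k X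

/-- The constraint qualification `N_𝒳(X) ∩ null C_k(X)ᵀ = {0}` for every node `k`. -/
def Qualification (X : P.Filt) : Prop :=
  ∀ k, ∀ U ∈ normalCone P.feasible X, (P.C k X)ᵀ * U = 0 → U = 0

end FilterProblem

/-! Constraints are imposed node by node, so replacing one block of the fixed point `X` by that of a
feasible `U` keeps feasibility and stays in the local search space of that node. Summing the
resulting inequalities over the nodes and using separability of `g`, `X` minimizes `P.blockwise X +
P.g` over the whole feasible set. This surrogate has the gradient of `f` at `X`
(`gradient_blockwise`), so its stationarity there is that of the original problem.

Stationarity of a constrained minimizer is `isStationaryPoint_of_isMinOn`: the variable is doubled,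
`F` on `C` and `g` free, with a quadratic penalty on the gap. Each half has its own first-order
condition; the local Lipschitz constant of `g` bounds the multipliers, and a limit finishes. -/

/-! ### Fermat's rule and the sum rule by quadratic penalty. -/

section SumRule

variable {E : Type*} [NormedAddCommGroup E] [InnerProductSpace ℝ E]

/-- First-order necessary condition: at a local minimizer over `C` of a differentiable function,
the negative gradient is a regular normal. -/
theorem neg_mem_regularNormalCone_of_isLocalMinOn {C : Set E} {h : E → ℝ} {v x : E} (hx : x ∈ C)
    (hd : HasFDerivAt h (innerSL ℝ v) x) (hmin : IsLocalMinOn h C x) :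
    -v ∈ regularNormalCone C x := by
  refine ⟨hx, fun ε hε => ?_⟩
  have h1 := hd.isLittleO.def hε
  have h2 : ∀ᶠ x' in 𝓝 x, x' ∈ C → h x ≤ h x' := eventually_nhdsWithin_iff.mp hmin
  obtain ⟨δ, hδ, hball⟩ := Metric.eventually_nhds_iff.mp (h1.and h2)
  refine ⟨δ, hδ, fun x' hx' hlt => ?_⟩
  obtain ⟨h3, h4⟩ := hball (by rwa [dist_eq_norm])
  have h5 := h4 hx'
  rw [Real.norm_eq_abs] at h3
  have h6 := (abs_le.mp h3).2
  rw [innerSL_apply_apply] at h6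
  rw [inner_neg_left]
  linarith

/-- At a local minimizer of the sum of a convex and a differentiable function, the negative
gradient of the latter is a subgradient of the former. -/
theorem neg_mem_subdifferential_of_isLocalMin {g h : E → ℝ} {v y : E}
    (hg : ConvexOn ℝ Set.univ g) (hd : HasFDerivAt h (innerSL ℝ v) y)
    (hmin : IsLocalMin (fun z => g z + h z) y) : -v ∈ subdifferential g y := by
  intro u
  have hline : HasDerivAt (fun t : ℝ => y + t • (u - y)) (u - y) 0 := by
    simpa using ((hasDerivAt_id (0 : ℝ)).smul_const (u - y)).const_add y
  have hd0 : HasFDerivAt h (innerSL ℝ v) (y + (0 : ℝ) • (u - y)) := by simpa using hd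
  have hcomp : HasDerivAt (fun t : ℝ => h (y + t • (u - y))) (innerSL ℝ v (u - y)) 0 :=
    hd0.comp_hasDerivAt (0 : ℝ) hline
  have hslope := hcomp.tendsto_slope_zero_right
  have hcont : Tendsto (fun t : ℝ => y + t • (u - y)) (𝓝[>] 0) (𝓝 y) := by
    have := hline.continuousAt.tendsto
    simp only [zero_smul, add_zero] at this
    exact this.mono_left nhdsWithin_le_nhds
  -- Minimality bounds the increase of `h` along the segment below by the decrease of `g`; convexity
  -- bounds that decrease below by `t * (g y - g u)`.
  have key : ∀ᶠ t : ℝ in 𝓝[>] 0,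
      -(g u - g y) ≤ t⁻¹ • (h (y + (0 + t) • (u - y)) - h (y + (0 : ℝ) • (u - y))) := by
    filter_upwards [hcont.eventually hmin, self_mem_nhdsWithin,
      Ioo_mem_nhdsGT (zero_lt_one' ℝ)] with t ht ht0 ht1
    have ht0 : 0 < t := ht0
    have hconv := hg.2 (Set.mem_univ y) (Set.mem_univ u) (sub_nonneg.mpr ht1.2.le) ht0.le
      (sub_add_cancel 1 t)
    have heq : (1 - t) • y + t • u = y + t • (u - y) := by module
    rw [heq, smul_eq_mul, smul_eq_mul] at hconv
    simp only [zero_add, zero_smul, add_zero, smul_eq_mul]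
    rw [inv_mul_eq_div, le_div_iff₀ ht0]
    linarith
  have hfin := ge_of_tendsto hslope key
  rw [innerSL_apply_apply] at hfin
  rw [inner_neg_left]
  linarith

/-- The graph of the subdifferential of a continuous function is closed. -/
theorem mem_subdifferential_of_tendsto {g : E → ℝ} (hg : Continuous g) {ys ss : ℕ → E} {y s : E}
    (hy : Tendsto ys atTop (𝓝 y)) (hs : Tendsto ss atTop (𝓝 s))
    (hmem : ∀ n, ss n ∈ subdifferential g (ys n)) : s ∈ subdifferential g y := fun u =>
  le_of_tendsto' (((hg.tendsto y).comp hy).add (hs.inner (tendsto_const_nhds.sub hy)))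
    fun n => hmem n u

/-- Serves both the coupling term and the localizing term around `x₀`; the latter carries the factor
`1 *` to match this form. -/
theorem hasFDerivAt_mul_norm_sub_sq (c : ℝ) (x y : E) :
    HasFDerivAt (fun z => c * ‖z - y‖ ^ 2) (innerSL ℝ ((2 * c) • (x - y))) x := by
  have h := (((hasFDerivAt_id x).sub_const y).norm_sq).const_mul c
  refine h.congr_fderiv ?_
  ext w
  simp
  ring

/-- The quadratic penalty used to decouple the smooth part and the convex part has a minimizer
which is controlled by the Lipschitz constant of the convex part. -/
theorem exists_penalty_minimizer [FiniteDimensional ℝ E] {C : Set E} (hC : IsClosed C)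
    {F g : E → ℝ} (hF : Continuous F) (hg : Continuous g) {x₀ : E} (hx₀ : x₀ ∈ C)
    (hmin : ∀ x ∈ C, F x₀ + g x₀ ≤ F x + g x) {r k : ℝ} (hr : 0 ≤ r) (hk0 : 0 ≤ k)
    (hk : ∀ x ∈ Metric.closedBall x₀ r, ∀ y ∈ Metric.closedBall x₀ r, g x - g y ≤ k * ‖x - y‖)
    {c : ℝ} (hc : 0 < c) :
    ∃ x y : E, x ∈ C ∧ c * ‖x - y‖ ≤ k ∧ c * ‖x - x₀‖ ^ 2 ≤ k ^ 2 ∧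
      IsMinOn (fun z => F z + (c * ‖z - y‖ ^ 2 + 1 * ‖z - x₀‖ ^ 2))
        (C ∩ Metric.closedBall x₀ r) x ∧
      IsMinOn (fun z => g z + c * ‖z - x‖ ^ 2) (Metric.closedBall x₀ r) y := by
  have hcpt : IsCompact ((C ∩ Metric.closedBall x₀ r) ×ˢ Metric.closedBall x₀ r) :=
    ((isCompact_closedBall x₀ r).inter_left hC).prod (isCompact_closedBall x₀ r)
  have hself := Metric.mem_closedBall_self (x := x₀) hr
  have hcont : Continuous fun p : E × E =>
      F p.1 + g p.2 + (c * ‖p.1 - p.2‖ ^ 2 + ‖p.1 - x₀‖ ^ 2) := by fun_prop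
  obtain ⟨⟨x, y⟩, ⟨⟨hxC, hxB⟩, hyB⟩, hxy⟩ :=
    hcpt.exists_isMinOn ⟨(x₀, x₀), ⟨hx₀, hself⟩, hself⟩ hcont.continuousOn
  simp only at hxC hxB hyB
  have h0 := hxy (show (x₀, x₀) ∈ _ from ⟨⟨hx₀, hself⟩, hself⟩)
  simp only [Set.mem_ofPred_eq, sub_self, norm_zero] at h0
  have h1 := hmin x hxC
  have h2 := hk x hxB y hyB
  -- Comparison with `(x₀, x₀)` and minimality of `x₀` leave the penalty at most `g x - g y`.
  have h3 : c * ‖x - y‖ ^ 2 + ‖x - x₀‖ ^ 2 ≤ k * ‖x - y‖ := by linarith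
  have hd := norm_nonneg (x - y)
  have hck : c * ‖x - y‖ ≤ k := by
    rcases hd.eq_or_lt with h | h
    · rwa [← h, mul_zero]
    · refine le_of_mul_le_mul_right ?_ h
      nlinarith [sq_nonneg ‖x - x₀‖]
  refine ⟨x, y, hxC, hck, ?_, ?_, ?_⟩
  · nlinarith [mul_nonneg hc.le hd, mul_le_mul_of_nonneg_left h3 hc.le,
      mul_le_mul_of_nonneg_left hck hk0, sq_nonneg (c * ‖x - y‖)]
  · intro z hz
    have := hxy (show (z, y) ∈ _ from ⟨hz, hyB⟩)
    simp only [Set.mem_ofPred_eq] at this ⊢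
    linarith
  · intro z hz
    have := hxy (show (x, z) ∈ _ from ⟨⟨hxC, hxB⟩, hz⟩)
    simp only [Set.mem_ofPred_eq] at this ⊢
    rw [norm_sub_rev y x, norm_sub_rev z x]
    linarith

/-- Fermat's rule together with the sum rule of variational analysis: a minimizer over a closed
set of the sum of a `C¹` function and a convex function is a stationary point. -/
theorem isStationaryPoint_of_isMinOn [FiniteDimensional ℝ E] [CompleteSpace E] {C : Set E}
    (hC : IsClosed C) {F g : E → ℝ} (hF : ContDiff ℝ 1 F) (hg : ConvexOn ℝ Set.univ g) {x₀ : E}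
    (hx₀ : x₀ ∈ C) (hmin : ∀ x ∈ C, F x₀ + g x₀ ≤ F x + g x) :
    IsStationaryPoint F g C x₀ := by
  have hgc : Continuous g := hg.locallyLipschitz.continuous
  obtain ⟨k, t, ht, hlip⟩ := hg.locallyLipschitz x₀
  obtain ⟨r, hr, hrt⟩ := Metric.nhds_basis_closedBall.mem_iff.mp ht
  have hk : ∀ x ∈ Metric.closedBall x₀ r, ∀ y ∈ Metric.closedBall x₀ r,
      g x - g y ≤ k * ‖x - y‖ := fun x hx y hy => by
    have := hlip.dist_le_mul x (hrt hx) y (hrt hy)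
    rw [Real.dist_eq, dist_eq_norm] at this
    exact (le_abs_self _).trans this
  have hpos : ∀ n : ℕ, (0 : ℝ) < n + 1 := fun n => by positivity
  choose xs ys hxC hxy hxx hxmin hymin using fun n : ℕ =>
    exists_penalty_minimizer hC hF.continuous hgc hx₀ hmin hr.le k.2 hk (hpos n)
  have hinv : Tendsto (fun n : ℕ => (1 : ℝ) / (n + 1)) atTop (𝓝 0) :=
    tendsto_one_div_add_atTop_nhds_zero_nat
  have hxlim : Tendsto xs atTop (𝓝 x₀) := by
    rw [tendsto_iff_norm_sub_tendsto_zero]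
    have hsq : Tendsto (fun n => ‖xs n - x₀‖ ^ 2) atTop (𝓝 0) := by
      refine squeeze_zero (fun n => sq_nonneg _) (fun n => ?_)
        (by simpa using hinv.const_mul ((k : ℝ) ^ 2))
      rw [← div_eq_mul_inv, le_div_iff₀ (hpos n), mul_comm]
      exact hxx n
    simpa using hsq.sqrt
  have hdiff : Tendsto (fun n => xs n - ys n) atTop (𝓝 0) := by
    rw [tendsto_zero_iff_norm_tendsto_zero]
    refine squeeze_zero (fun n => norm_nonneg _) (fun n => ?_)
      (by simpa using hinv.const_mul (k : ℝ))
    rw [← div_eq_mul_inv, le_div_iff₀ (hpos n), mul_comm]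
    exact hxy n
  have hylim : Tendsto ys atTop (𝓝 x₀) := by simpa using hxlim.sub hdiff
  -- The gradient of the coupling term in `x`, and minus its gradient in `y`: one multiplier shared
  -- by both optimality conditions.
  set ss : ℕ → E := fun n => (2 * ((n : ℝ) + 1)) • (xs n - ys n) with hss
  have hsB : ∀ n, ss n ∈ Metric.closedBall (0 : E) (2 * k) := fun n => by
    rw [mem_closedBall_zero_iff, hss, norm_smul, Real.norm_eq_abs,
      abs_of_pos (mul_pos two_pos (hpos n)), mul_assoc]
    exact mul_le_mul_of_nonneg_left (hxy n) two_pos.le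
  obtain ⟨s, -, σ, hσ, hsσ⟩ := (isCompact_closedBall (0 : E) (2 * k)).tendsto_subseq hsB
  have hball : Metric.closedBall x₀ r ∈ 𝓝 x₀ := Metric.closedBall_mem_nhds x₀ hr
  -- Once the ball is a neighborhood of both points, it no longer acts as a constraint; the shift by
  -- `N` makes this hold for every index.
  have hint : ∀ᶠ n in atTop, Metric.closedBall x₀ r ∈ 𝓝 (xs (σ n)) ∧
      Metric.closedBall x₀ r ∈ 𝓝 (ys (σ n)) :=
    ((hxlim.comp hσ.tendsto_atTop).eventually (eventually_mem_nhds_iff.mpr hball)).and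
      ((hylim.comp hσ.tendsto_atTop).eventually (eventually_mem_nhds_iff.mpr hball))
  obtain ⟨N, hN⟩ := eventually_atTop.mp hint
  set τ : ℕ → ℕ := fun n => σ (n + N) with hτ
  have hτlim : Tendsto τ atTop atTop := hσ.tendsto_atTop.comp (tendsto_add_atTop_nat N)
  have hsτ : Tendsto (fun n => ss (τ n)) atTop (𝓝 s) := hsσ.comp (tendsto_add_atTop_nat N)
  have hsub : s ∈ subdifferential g x₀ := by
    refine mem_subdifferential_of_tendsto hgc (hylim.comp hτlim) hsτ fun n => ?_
    have h := neg_mem_subdifferential_of_isLocalMin hg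
      (hasFDerivAt_mul_norm_sub_sq ((τ n : ℝ) + 1) (ys (τ n)) (xs (τ n)))
      ((hymin (τ n)).isLocalMin (hN (n + N) (Nat.le_add_left N n)).2)
    rwa [← smul_neg, neg_sub] at h
  have hgradF : ∀ x, HasFDerivAt F (innerSL ℝ (gradient F x)) x := fun x =>
    ((hF.differentiable one_ne_zero) x).hasGradientAt.hasFDerivAt
  have hgradc : Continuous (gradient F) :=
    (InnerProductSpace.toDual ℝ E).symm.continuous.comp (hF.continuous_fderiv one_ne_zero)
  have hnor : -(gradient F x₀ + s) ∈ normalCone C x₀ := by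
    refine ⟨hx₀, fun n => xs (τ n),
      fun n => -(gradient F (xs (τ n)) + (ss (τ n) + (2 * (1 : ℝ)) • (xs (τ n) - x₀))),
      hxlim.comp hτlim, ?_, fun n => ?_⟩
    · have h1 : Tendsto (fun n => (2 * (1 : ℝ)) • (xs (τ n) - x₀)) atTop (𝓝 0) := by
        simpa using ((hxlim.comp hτlim).sub_const x₀).const_smul (2 * (1 : ℝ))
      simpa using (((hgradc.tendsto x₀).comp (hxlim.comp hτlim)).add (hsτ.add h1)).neg
    · refine neg_mem_regularNormalCone_of_isLocalMinOn (hxC _) ?_ ?_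
        (h := fun z => F z + (((τ n : ℝ) + 1) * ‖z - ys (τ n)‖ ^ 2 + 1 * ‖z - x₀‖ ^ 2))
      · rw [map_add, map_add]
        exact (hgradF _).add ((hasFDerivAt_mul_norm_sub_sq _ _ _).add
          (hasFDerivAt_mul_norm_sub_sq _ _ _))
      · have hm := (hxmin (τ n)).localize
        rwa [IsLocalMinOn, nhdsWithin_inter_of_mem' (mem_nhdsWithin_of_mem_nhds
          (hN (n + N) (Nat.le_add_left N n)).1)] at hm
  exact ⟨gradient F x₀ + s, ⟨gradient F x₀, rfl, s, hsub, rfl⟩, _, hnor, by simp⟩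

end SumRule

/-! ### Block replacement and the blockwise surrogate. -/

namespace FilterProblem

variable {K Q : ℕ} {H : Type*} [AddCommGroup H] [Module ℝ H] (P : FilterProblem K Q H)

/-- The filter `U` with all blocks other than the `q`-th one set to zero, as a linear map. -/
def blockProj (q : Fin K) : P.Filt →ₗ[ℝ] P.Filt where
  toFun U := Matrix.of fun r s => if r.1 = q then U r s else 0
  map_add' U V := by ext r s; by_cases h : r.1 = q <;> simp [h]
  map_smul' c U := by ext r s; by_cases h : r.1 = q <;> simp [h]

theorem sum_blockProj (U : P.Filt) : ∑ q, P.blockProj q U = U := by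
  ext r s
  simp [blockProj, Matrix.sum_apply]

/-- The filter `X` with its `q`-th block replaced by that of `U`. -/
def replaceBlock (X : P.Filt) (q : Fin K) (U : P.Filt) : P.Filt := X + P.blockProj q (U - X)

theorem replaceBlock_apply (X : P.Filt) (q : Fin K) (U : P.Filt) (r : P.Channel) (s : Fin Q) :
    P.replaceBlock X q U r s = if r.1 = q then U r s else X r s := by
  by_cases h : r.1 = q <;> simp [replaceBlock, blockProj, h]

theorem replaceBlock_self (X : P.Filt) (q : Fin K) : P.replaceBlock X q X = X := by
  simp [replaceBlock]

theorem blk_replaceBlock (X : P.Filt) (q : Fin K) (U : P.Filt) (k : Fin K) :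
    P.blk (P.replaceBlock X q U) k = if k = q then P.blk U k else P.blk X k := by
  ext i s
  by_cases h : k = q <;> simp [blk, replaceBlock_apply, h]

/-- The feasible set is a product of per-node sets, so blocks can be mixed freely. -/
theorem replaceBlock_mem_feasible {X U : P.Filt} (hX : X ∈ P.feasible) (hU : U ∈ P.feasible)
    (q : Fin K) : P.replaceBlock X q U ∈ P.feasible := by
  intro k
  rw [blk_replaceBlock]
  split_ifs
  · exact hU k
  · exact hX k

/-- The other nodes may keep their blocks, by taking identity matrices for their compressed
channels. -/
theorem replaceBlock_mem_S (X : P.Filt) (q : Fin K) (U : P.Filt) :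
    P.replaceBlock X q U ∈ P.S q X := by
  refine ⟨Matrix.of fun c s => match c with
    | Sum.inl i => U ⟨q, i⟩ s
    | Sum.inr (_, s') => if s' = s then 1 else 0, ?_⟩
  ext ⟨k, i⟩ s
  rw [replaceBlock_apply, Matrix.mul_apply, Fintype.sum_sum_type, Fintype.sum_prod_type]
  by_cases h : k = q
  · subst h
    have h1 : ∀ x : {k' : Fin K // k' ≠ k}, k ≠ x.1 := fun x => x.2.symm
    simp [C, h1]
  · have h1 : ∀ j, (⟨k, i⟩ : P.Channel) ≠ ⟨q, j⟩ := fun j hj => h (congrArg Sigma.fst hj)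
    have h2 : ∀ x : {k' : Fin K // k' ≠ q}, k = x.1 ↔ x = ⟨k, h⟩ := fun x =>
      ⟨fun e => Subtype.ext e.symm, fun e => e ▸ rfl⟩
    simp [C, h1, h2, h]

theorem isClosed_feasible (hP : P.IsAdmissible) : IsClosed P.feasible := by
  have hblk : ∀ k, Continuous fun X : P.Filt => P.blk X k := fun k =>
    continuous_matrix fun i s => continuous_id.matrix_elem _ _
  have hcon : ∀ k, ∀ j ∈ P.JI k ∪ P.JE k, Continuous fun X => P.constraint k j (P.blk X k) :=
    fun k j hj => (hP.smooth_constraints k j hj).continuous.comp (hblk k)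
  simp only [feasible, Set.ofPred_forall, Set.ofPred_and]
  exact isClosed_iInter fun k => (isClosed_iInter fun j => isClosed_iInter fun hj =>
    isClosed_le (hcon k j (Or.inl hj)) continuous_const).inter
    (isClosed_iInter fun j => isClosed_iInter fun hj =>
      isClosed_eq (hcon k j (Or.inr hj)) continuous_const)

theorem convexOn_g (hγ : ConvexOn ℝ Set.univ P.γ) : ConvexOn ℝ Set.univ P.g := by
  refine ⟨convex_univ, fun X _ Y _ a b ha hb hab => ?_⟩
  have h := hγ.2 (Set.mem_univ (Xᵀ * P.A)) (Set.mem_univ (Yᵀ * P.A)) ha hb hab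
  simpa only [g, Matrix.transpose_add, Matrix.transpose_smul, Matrix.add_mul,
    Matrix.smul_mul] using h

/-- By separability, replacing block `q` changes only the `q`-th summand of `g`. -/
theorem g_sub_eq_sum_replaceBlock (hP : P.IsAdmissible) (X U : P.Filt) :
    P.g U - P.g X = ∑ q, (P.g (P.replaceBlock X q U) - P.g X) := by
  obtain ⟨γblk, hγ⟩ := hP.separable
  simp only [g, hγ, blk_replaceBlock, ← Finset.sum_sub_distrib]
  refine Finset.sum_congr rfl fun q _ => ?_
  rw [Finset.sum_eq_single q (fun k _ hk => by simp [hk]) (by simp)]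
  simp

/-- The sum over the nodes of the variations of `f` in the block of one node. -/
noncomputable def blockwise (X U : P.Filt) : ℝ := ∑ q, (P.f (P.replaceBlock X q U) - P.f X)

theorem contDiff_replaceBlock (X : P.Filt) (q : Fin K) : ContDiff ℝ 1 (P.replaceBlock X q) :=
  contDiff_const.add
    ((LinearMap.toContinuousLinearMap (P.blockProj q)).contDiff.comp
      (contDiff_id.sub contDiff_const))

theorem contDiff_blockwise (hP : P.IsAdmissible) (X : P.Filt) :
    ContDiff ℝ 1 (P.blockwise X) :=
  ContDiff.sum fun q _ =>
    (hP.smooth_objective.comp (P.contDiff_replaceBlock X q)).sub contDiff_const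

/-- Replacing block `q` fixes `X` and has derivative `blockProj q`; by the chain rule all terms
involve the derivative of `f` at `X`, and the projections sum to the identity. -/
theorem gradient_blockwise (hP : P.IsAdmissible) (X : P.Filt) :
    gradient (P.blockwise X) X = gradient P.f X := by
  have hf : HasFDerivAt P.f (fderiv ℝ P.f X) X :=
    (hP.smooth_objective.differentiable one_ne_zero X).hasFDerivAt
  have hsum : HasFDerivAt (P.blockwise X)
      (∑ q, (fderiv ℝ P.f X).comp (LinearMap.toContinuousLinearMap (P.blockProj q))) X := by
    refine HasFDerivAt.fun_sum fun q _ => HasFDerivAt.sub_const _ ?_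
    have hr : HasFDerivAt (P.replaceBlock X q)
        (LinearMap.toContinuousLinearMap (P.blockProj q)) X :=
      ((LinearMap.toContinuousLinearMap (P.blockProj q)).hasFDerivAt.comp X
        ((hasFDerivAt_id X).sub_const X)).const_add X
    have hf' : HasFDerivAt P.f (fderiv ℝ P.f X) (P.replaceBlock X q X) := by
      rwa [P.replaceBlock_self]
    exact hf'.comp X hr
  have heq : ∑ q, (fderiv ℝ P.f X).comp (LinearMap.toContinuousLinearMap (P.blockProj q)) =
      fderiv ℝ P.f X := by
    ext1 U
    simp only [sum_apply, ContinuousLinearMap.comp_apply,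
      LinearMap.coe_toContinuousLinearMap']
    rw [← map_sum, P.sum_blockProj]
  exact congrArg (InnerProductSpace.toDual ℝ P.Filt).symm (hsum.fderiv.trans heq)

end FilterProblem

theorem proposition3 {K Q : ℕ} {H : Type*} [AddCommGroup H] [Module ℝ H]
    (P : FilterProblem K Q H) (hP : P.IsAdmissible) (hass : P.ContinuityCompactnessCCP)
    (X : P.Filt) (hfix : P.IsFixedPoint X)
    (hqual : P.Qualification X) :
    IsStationaryPoint P.f P.g P.feasible X := by
  have hmain (hX : X ∈ P.feasible) : IsStationaryPoint P.f P.g P.feasible X := by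
    have h := isStationaryPoint_of_isMinOn (P.isClosed_feasible hP) (P.contDiff_blockwise hP X)
      (P.convexOn_g hass.convex) hX fun U hU => by
        have h0 : P.blockwise X X = 0 := by simp [FilterProblem.blockwise, P.replaceBlock_self]
        have h1 : 0 ≤ ∑ q, (P.L (P.replaceBlock X q U) - P.L X) :=
          Finset.sum_nonneg fun q _ => sub_nonneg.mpr
            ((hfix q).2 _ ⟨P.replaceBlock_mem_feasible hX hU q, P.replaceBlock_mem_S X q U⟩)
        have h2 : ∑ q, (P.L (P.replaceBlock X q U) - P.L X) =
            P.blockwise X U + (P.g U - P.g X) := by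
          rw [P.g_sub_eq_sum_replaceBlock hP, FilterProblem.blockwise, ← Finset.sum_add_distrib]
          exact Finset.sum_congr rfl fun q _ => by rw [FilterProblem.L, FilterProblem.L]; ring
        linarith
    rwa [IsStationaryPoint, P.gradient_blockwise hP] at h
  -- The constraints of node `k` come from the fixed-point property at `k` itself, so no node has to
  -- be chosen and `K = 0` is covered.
  exact hmain fun k => (hfix k).1.1 k
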